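/- A left module $M$ over an associative ring $S$ with $1$ is said to be of type $FP_m$ ($m\ge 0$) if it has a projective resolution $\cdots\to P_i\to P_{i-1}\to\cdots\to P_0\to M\to 0$ with $P_i$ finitely generated for all $i\le m$. A group $G$ is of type $FP_m$ if the trivial $\mathbb{Z}G$-module $\mathbb{Z}$ is of type $FP_m$. **Theorem A.** Let $n\ge 1$ be a natural number and let $1\to A\xrightarrow{\iota} B\xrightarrow{\pi} C\to 1$ be a short exact sequence of groups with $A$ of type $FP_n$ and $C$ of type $FP_{n+1}$. Suppose that there is another short exact sequence of groups $1\to A\xrightarrow{\iota_0} B_0\xrightarrow{\pi_0} C_0\to 1$ with $B_0$ of type $FP_{n+1}$, and a group homomorphism $\theta\colon B_0\to B$ that restricts to the identity on $A$, i.e. $\theta\circ\iota_0=\iota$. Then $B$ is of type $FP_{n+1}$. -/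

import Mathlib

universe u v

/-- A left module `M` over an associative unital ring `S` is of type `FP_n` if there is a projective
resolution `⋯ → P (i + 1) → P i → ⋯ → P 0 → M → 0` over `S` in which `P i` is finitely generated
for all `i ≤ n`. The maps of the resolution are `d i : P (i + 1) → P i` and the augmentation
`ε : P 0 → M`. -/
def Module.IsOfTypeFP (S : Type u) [Ring S] (M : Type v) [AddCommGroup M] [Module S M]
    (n : ℕ) : Prop :=
  ∃ (P : ℕ → Type (max u v)) (_ : ∀ i, AddCommGroup (P i)) (_ : ∀ i, Module S (P i))
    (d : ∀ i, P (i + 1) →ₗ[S] P i) (ε : P 0 →ₗ[S] M),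
    (∀ i, Module.Projective S (P i)) ∧
    Function.Surjective ε ∧
    Function.Exact (d 0) ε ∧
    (∀ i, Function.Exact (d (i + 1)) (d i)) ∧
    ∀ i ≤ n, Module.Finite S (P i)

/-- A group `G` is of type `FP_n` if the trivial module `ℤ` over the integral group ring `ℤ[G]`
is of type `FP_n`. -/
def Group.IsOfTypeFP (G : Type u) [Group G] (n : ℕ) : Prop :=
  Module.IsOfTypeFP (MonoidAlgebra ℤ G) (Representation.trivial ℤ G ℤ).asModule n

-- Type `FP_m` is treated as the existence of `m + 1` finite free terms of a resolution, so that
-- dimension shifting becomes induction on the number of terms. Cover the trivial module by `ℤC^k →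
-- ℤ` with kernel of type `FP_n` over `ℤC`, and regard everything over `ℤB`. The module `ℤC` is
-- induced from the trivial `ℤA`-module `ℤ`, hence of type `FP_n` over `ℤB` (`of_isInduced`), and
-- therefore so is the kernel (`of_ringHom`). By itself this only makes `ℤ` of type `FP_n` over
-- `ℤB`. The missing degree comes from `B₀`: the composite `ℤ^k → ℤC^k → ℤ` is given by integers, so
-- it factors through the trivial `ℤB₀`-module `ℤ^k`, which is of type `FP_(n+1)`. The lemma
-- `of_factorization` passes to syzygies one degree at a time. The factorization survives up to an
-- error through a finite projective module, and in the last degree it confines the image of the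
-- induced module to a finitely generated submodule.

universe w t x

/-! ### Semilinear maps: kernels and lifting. -/

/-- The restriction of a semilinear map to the kernels of two linear maps. -/
def LinearMap.kerMap {S T N N' M M' : Type*} [Ring S] [Ring T] {σ : S →+* T}
    [AddCommGroup N] [Module S N] [AddCommGroup N'] [Module S N']
    [AddCommGroup M] [Module T M] [AddCommGroup M'] [Module T M']
    (f : N →ₛₗ[σ] M) (p : N →ₗ[S] N') (q : M →ₗ[T] M')
    (h : ∀ x, p x = 0 → q (f x) = 0) :
    LinearMap.ker p →ₛₗ[σ] LinearMap.ker q :=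
  (f.comp (LinearMap.ker p).subtype).codRestrict _ fun x => h x x.2

/-- A semilinear map out of a projective module lifts along surjective linear maps. -/
theorem Module.Projective.exists_semilinear_lift {S T P M Q : Type*} [Ring S] [Ring T]
    {σ : S →+* T} [AddCommGroup P] [Module S P] [Module.Projective S P]
    [AddCommGroup M] [Module T M] [AddCommGroup Q] [Module T Q]
    (q : Q →ₗ[T] M) (hq : Function.Surjective q) (f : P →ₛₗ[σ] M) :
    ∃ g : P →ₛₗ[σ] Q, ∀ x, q (g x) = f x := by
  -- Restriction of scalars along `σ` turns semilinear maps into `S`-linear ones.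
  let _ := Module.compHom M σ
  let _ := Module.compHom Q σ
  let q' : Q →ₗ[S] M :=
    { toFun := q, map_add' := q.map_add, map_smul' := fun r x => q.map_smul (σ r) x }
  let f' : P →ₗ[S] M :=
    { toFun := f, map_add' := f.map_add, map_smul' := fun r x => f.map_smulₛₗ r x }
  obtain ⟨g, hg⟩ := Module.projective_lifting_property q' f' hq
  exact ⟨{ toFun := g, map_add' := g.map_add, map_smul' := fun r x => g.map_smul r x },
    fun x => LinearMap.congr_fun hg x⟩

/-! ### Partial resolutions by finite free modules. -/

section PartialResolution

/-- A submodule `K` of a finite free module admits an exact sequence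
`F (n - 1) → ⋯ → F 0 → K → 0` of `n` finite free modules. -/
def Submodule.HasFreePartialResolution (S : Type*) [Ring S] :
    ℕ → ∀ {k : ℕ}, Submodule S (Fin k → S) → Prop
  | 0, _, _ => True
  | n + 1, k, K => ∃ (l : ℕ) (f : (Fin l → S) →ₗ[S] (Fin k → S)),
      LinearMap.range f = K ∧ HasFreePartialResolution S n (LinearMap.ker f)

/-- The module `M` admits an exact sequence `F (n - 1) → ⋯ → F 0 → M → 0` of `n` finite
free modules. For `n = m + 1` this says that `M` is of type `FP_m`. -/
def Module.HasFreePartialResolution (S : Type*) [Ring S] (n : ℕ) (M : Type*) [AddCommGroup M]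
    [Module S M] : Prop :=
  match n with
  | 0 => True
  | n + 1 => ∃ (l : ℕ) (f : (Fin l → S) →ₗ[S] M),
      Function.Surjective f ∧ Submodule.HasFreePartialResolution S n (LinearMap.ker f)

namespace Module.HasFreePartialResolution

variable {S : Type*} [Ring S]
variable {M : Type*} [AddCommGroup M] [Module S M]
variable {M' : Type*} [AddCommGroup M'] [Module S M']
variable {M'' : Type*} [AddCommGroup M''] [Module S M'']
variable {F : Type*} [AddCommGroup F] [Module S F]
variable {R : Type u} [Ring R]

theorem zero : HasFreePartialResolution S 0 M := trivial

theorem congr {n : ℕ} (e : M ≃ₗ[S] M') (h : HasFreePartialResolution S n M) :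
    HasFreePartialResolution S n M' := by
  cases n with
  | zero => trivial
  | succ n =>
    obtain ⟨l, f, hf, hK⟩ := h
    refine ⟨l, e.toLinearMap ∘ₗ f, e.surjective.comp hf, ?_⟩
    rwa [LinearEquiv.ker_comp]

/-- The recursive definition stays among submodules of `Fin k → S` and so never changes universe.
This bridge yields `succ_iff`, the recursion for abstract modules that is used everywhere else. -/
theorem submodule_iff {n k : ℕ} (K : Submodule S (Fin k → S)) :
    K.HasFreePartialResolution S n ↔ HasFreePartialResolution S n K := by
  cases n with
  | zero => exact Iff.rfl
  | succ n =>
    constructor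
    · rintro ⟨l, f, rfl, hK⟩
      refine ⟨l, f.rangeRestrict, f.surjective_rangeRestrict, ?_⟩
      rwa [LinearMap.ker_rangeRestrict]
    · rintro ⟨l, f, hf, hK⟩
      refine ⟨l, K.subtype ∘ₗ f, ?_, ?_⟩
      · rw [LinearMap.range_comp, LinearMap.range_eq_top.mpr hf, Submodule.map_top,
          Submodule.range_subtype]
      · rwa [LinearMap.ker_comp_of_ker_eq_bot _ K.ker_subtype]

theorem succ_iff {n : ℕ} : HasFreePartialResolution S (n + 1) M ↔
    ∃ (l : ℕ) (f : (Fin l → S) →ₗ[S] M),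
      Function.Surjective f ∧ HasFreePartialResolution S n (LinearMap.ker f) := by
  simp only [← submodule_iff]
  exact Iff.rfl

/-- Kernels of two maps that differ by an equivalence of the sources are equivalent. -/
theorem ker_comp_equiv {n : ℕ} (e : M ≃ₗ[S] M') (f : M' →ₗ[S] M'')
    (h : HasFreePartialResolution S n (LinearMap.ker f)) :
    HasFreePartialResolution S n (LinearMap.ker (f ∘ₗ e.toLinearMap)) := by
  refine h.congr (LinearEquiv.symm ?_)
  rw [LinearMap.ker_comp]
  exact e.submoduleMap _ |>.trans <| LinearEquiv.ofEq _ _ <| by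
    rw [Submodule.map_comap_eq_of_surjective e.surjective]

theorem succ_of_free [Module.Free S F] [Module.Finite S F] {n : ℕ} (f : F →ₗ[S] M)
    (hf : Function.Surjective f) (h : HasFreePartialResolution S n (LinearMap.ker f)) :
    HasFreePartialResolution S (n + 1) M := by
  let b := Module.Free.chooseBasis S F
  let e : (Fin (Fintype.card (Module.Free.ChooseBasisIndex S F)) → S) ≃ₗ[S] F :=
    (b.reindex (Fintype.equivFin _)).equivFun.symm
  exact succ_iff.mpr ⟨_, f ∘ₗ e.toLinearMap, hf.comp e.surjective, h.ker_comp_equiv e⟩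

theorem of_exact_left {n : ℕ} (i : M' →ₗ[S] M) (g : M →ₗ[S] M'') (hi : Function.Injective i)
    (hig : Function.Exact i g) (h : HasFreePartialResolution S n M') :
    HasFreePartialResolution S n (LinearMap.ker g) :=
  h.congr <| (LinearEquiv.ofInjective i hi).trans <|
    LinearEquiv.ofEq _ _ (LinearMap.exact_iff.mp hig).symm

/-- If the horseshoe lemma holds for the kernels of free covers, then it holds one step up. -/
theorem of_extension_step {n : ℕ}
    (ih : ∀ (K K'' : Type u) [AddCommGroup K] [Module R K] [AddCommGroup K''] [Module R K'']
      (g : K →ₗ[R] K''), Function.Surjective g → HasFreePartialResolution R n (LinearMap.ker g) →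
      HasFreePartialResolution R n K'' → HasFreePartialResolution R n K)
    {M : Type*} [AddCommGroup M] [Module R M] {M'' : Type*} [AddCommGroup M''] [Module R M'']
    (g : M →ₗ[R] M'') (hg : Function.Surjective g)
    (hK : HasFreePartialResolution R (n + 1) (LinearMap.ker g))
    (hM : HasFreePartialResolution R (n + 1) M'') : HasFreePartialResolution R (n + 1) M := by
  obtain ⟨k, p, hp, hpK⟩ := succ_iff.mp hK
  obtain ⟨l, q, hq, hqK⟩ := succ_iff.mp hM
  obtain ⟨r, hr⟩ := Module.projective_lifting_property g q hg
  replace hr : ∀ y, g (r y) = q y := LinearMap.congr_fun hr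
  have hgp (x) : g (p x) = 0 := (p x).2
  let f := ((LinearMap.ker g).subtype ∘ₗ p).coprod r
  have hf (z) : f z = p z.1 + r z.2 := rfl
  have hgf (z) (hz : f z = 0) : q z.2 = 0 := by
    have := congrArg g hz
    rwa [hf, map_add, hgp, zero_add, hr, map_zero] at this
  refine succ_of_free f (fun m => ?_) ?_
  · obtain ⟨y, hy⟩ := hq (g m)
    obtain ⟨x, hx⟩ := hp ⟨m - r y, by simp [hr, hy]⟩
    exact ⟨(x, y), by rw [hf, hx]; simp⟩
  -- The kernels form an extension `0 → ker p → ker f → ker q → 0`, to which `ih` applies.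
  · let s := (LinearMap.snd R (Fin k → R) (Fin l → R)).kerMap f q hgf
    refine ih _ _ s (fun y => ?_) ?_ hqK
    · obtain ⟨x, hx⟩ := hp ⟨- r y, by simp [hr]⟩
      exact ⟨⟨(x, y), by simp [hf, hx]⟩, rfl⟩
    · refine of_exact_left ((LinearMap.inl R (Fin k → R) (Fin l → R)).kerMap p f
        fun x hx => by simp [hf, hx]) s (fun x y hxy => ?_) (fun z => ?_) hpK
      · exact Subtype.ext (congrArg Prod.fst (Subtype.ext_iff.mp hxy))
      · constructor
        · intro hz
          have h2 : z.1.2 = 0 := congrArg Subtype.val hz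
          have h1 : f z.1 = 0 := z.2
          refine ⟨⟨z.1.1, ?_⟩, Subtype.ext (Prod.ext rfl h2.symm)⟩
          rw [hf, h2, map_zero, add_zero] at h1
          exact Subtype.ext h1
        · rintro ⟨x, rfl⟩
          rfl

/-- The horseshoe lemma. -/
theorem of_extension {n : ℕ} {M : Type*} [AddCommGroup M] [Module R M]
    {M'' : Type*} [AddCommGroup M''] [Module R M'']
    (g : M →ₗ[R] M'') (hg : Function.Surjective g)
    (hK : HasFreePartialResolution R n (LinearMap.ker g))
    (hM : HasFreePartialResolution R n M'') : HasFreePartialResolution R n M := by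
  -- After one step all modules are kernels inside finite powers of `R`, hence live in the universe
  -- of `R`. The induction runs there, and one further step reaches arbitrary universes.
  have key (n : ℕ) : ∀ (K K'' : Type u) [AddCommGroup K] [Module R K] [AddCommGroup K'']
      [Module R K''] (g : K →ₗ[R] K''), Function.Surjective g →
      HasFreePartialResolution R n (LinearMap.ker g) →
      HasFreePartialResolution R n K'' → HasFreePartialResolution R n K := by
    induction n with
    | zero => intros; exact zero
    | succ n ih => intro K K'' _ _ _ _ g; exact of_extension_step ih g
  cases n with
  | zero => exact zero
  | succ n => exact of_extension_step (key n) g hg hK hM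

theorem of_succ {n : ℕ} {M : Type*} [AddCommGroup M] [Module R M]
    (h : HasFreePartialResolution R (n + 1) M) : HasFreePartialResolution R n M := by
  have key (n : ℕ) : ∀ (K : Type u) [AddCommGroup K] [Module R K],
      HasFreePartialResolution R (n + 1) K → HasFreePartialResolution R n K := by
    induction n with
    | zero => intros; exact zero
    | succ n ih =>
      intro K _ _ h
      obtain ⟨l, f, hf, hK⟩ := succ_iff.mp h
      exact succ_iff.mpr ⟨l, f, hf, ih _ hK⟩
  cases n with
  | zero => exact zero
  | succ n =>
    obtain ⟨l, f, hf, hK⟩ := succ_iff.mp h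
    exact succ_iff.mpr ⟨l, f, hf, key n _ hK⟩

/-- Quotients of modules of type `FP_n` by submodules of type `FP_(n-1)` are of type `FP_n`. -/
theorem of_quotient {n : ℕ} {M : Type*} [AddCommGroup M] [Module R M]
    {M'' : Type*} [AddCommGroup M''] [Module R M'']
    (g : M →ₗ[R] M'') (hg : Function.Surjective g)
    (hK : HasFreePartialResolution R n (LinearMap.ker g))
    (hM : HasFreePartialResolution R (n + 1) M) : HasFreePartialResolution R (n + 1) M'' := by
  obtain ⟨k, p, hp, hpK⟩ := succ_iff.mp hM
  refine succ_iff.mpr ⟨k, g ∘ₗ p, hg.comp hp, ?_⟩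
  -- The horseshoe lemma is applied to `0 → ker p → ker (g ∘ p) → ker g → 0`.
  let s := p.kerMap (g ∘ₗ p) g fun _ h => h
  refine of_extension s (fun y => ?_) ?_ hK
  · obtain ⟨x, hx⟩ := hp y
    exact ⟨⟨x, (congrArg g hx).trans y.2⟩, Subtype.ext hx⟩
  · refine of_exact_left ((LinearMap.id).kerMap p (g ∘ₗ p) fun x hx => by simp [hx]) s
      (fun x y hxy => Subtype.ext (Subtype.ext_iff.mp hxy :)) (fun z => ?_) hpK
    constructor
    · exact fun hz => ⟨⟨z, congrArg Subtype.val hz⟩, rfl⟩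
    · rintro ⟨x, rfl⟩
      exact Subtype.ext x.2

theorem _root_.Module.Finite.projective_ker_and_finite_ker {k : ℕ} {P : Type*} [AddCommGroup P]
    [Module R P] (f : (Fin k → R) →ₗ[R] P) (g : P →ₗ[R] (Fin k → R))
    (hfg : f ∘ₗ g = LinearMap.id) :
    Module.Projective R (LinearMap.ker f) ∧ Module.Finite R (LinearMap.ker f) := by
  have hfg' (x) : f (g x) = x := LinearMap.congr_fun hfg x
  let s : (Fin k → R) →ₗ[R] LinearMap.ker f :=
    -- The complementary idempotent retracts `P` onto `ker f`.
    (LinearMap.id - g ∘ₗ f).codRestrict _ fun x => by simp [hfg']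
  have hs : s ∘ₗ (LinearMap.ker f).subtype = LinearMap.id := by
    ext x : 2
    simp [s]
  exact ⟨Module.Projective.of_split _ s hs,
    Module.Finite.of_surjective s fun x => ⟨x, LinearMap.congr_fun hs x⟩⟩

theorem of_projective (n : ℕ) {P : Type*} [AddCommGroup P] [Module R P] [Module.Projective R P]
    [Module.Finite R P] : HasFreePartialResolution R n P := by
  have key (n : ℕ) : ∀ (P : Type u) [AddCommGroup P] [Module R P] [Module.Projective R P]
      [Module.Finite R P], HasFreePartialResolution R n P := by
    induction n with
    | zero => intros; exact zero
    | succ n ih =>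
      intro P _ _ _ _
      obtain ⟨k, f, g, hf, -, hfg⟩ := Module.Finite.exists_comp_eq_id_of_projective R P
      obtain ⟨_, _⟩ := Module.Finite.projective_ker_and_finite_ker f g hfg
      exact succ_iff.mpr ⟨k, f, hf, ih _⟩
  cases n with
  | zero => exact zero
  | succ n =>
    obtain ⟨k, f, g, hf, -, hfg⟩ := Module.Finite.exists_comp_eq_id_of_projective R P
    obtain ⟨_, _⟩ := Module.Finite.projective_ker_and_finite_ker f g hfg
    exact succ_iff.mpr ⟨k, f, hf, key n _⟩

theorem succ_of_projective {n : ℕ} {P : Type*} [AddCommGroup P] [Module R P]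
    [Module.Projective R P] [Module.Finite R P] {M : Type*} [AddCommGroup M] [Module R M]
    (f : P →ₗ[R] M) (hf : Function.Surjective f)
    (h : HasFreePartialResolution R n (LinearMap.ker f)) :
    HasFreePartialResolution R (n + 1) M :=
  of_quotient f hf h (of_projective _)

theorem pi {n : ℕ} {M : Type*} [AddCommGroup M] [Module R M]
    (h : HasFreePartialResolution R n M) (k : ℕ) :
    HasFreePartialResolution R n (Fin k → M) := by
  induction k with
  | zero =>
    exact of_projective n
  | succ k ih =>
    let e := Fin.consLinearEquiv R fun _ : Fin (k + 1) => M
    refine congr e (of_extension (LinearMap.fst R M (Fin k → M)) LinearMap.fst_surjective ?_ h)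
    exact of_exact_left (LinearMap.inr R M (Fin k → M)) _ LinearMap.inr_injective
      (fun z => by simp [Prod.ext_iff, eq_comm]) ih

end Module.HasFreePartialResolution
end PartialResolution

/-! ### Comparison with projective resolutions. -/

namespace Module.HasFreePartialResolution

variable {R : Type u} [Ring R]

theorem ker_succ_of_exact {P Q N : Type*} [AddCommGroup P] [Module R P] [AddCommGroup Q]
    [Module R Q] [AddCommGroup N] [Module R N] [Module.Projective R P] [Module.Finite R P]
    (f : P →ₗ[R] Q) (g : Q →ₗ[R] N) (hfg : Function.Exact f g) {n : ℕ}
    (h : HasFreePartialResolution R n (LinearMap.ker f)) :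
    HasFreePartialResolution R (n + 1) (LinearMap.ker g) := by
  refine succ_of_projective
    (f.codRestrict (LinearMap.ker g) fun x => LinearMap.mem_ker.mpr (hfg.apply_apply_eq_zero x))
    (fun x => ?_) ?_
  · obtain ⟨y, hy⟩ := (hfg x).mp x.2
    exact ⟨y, Subtype.ext hy⟩
  · rwa [LinearMap.ker_codRestrict]

/-- The kernel of `d j` is the image of `P (j + 2)`, which explains the shift in `hfin`. -/
theorem ker_of_exact_seq {P : ℕ → Type*} [∀ i, AddCommGroup (P i)] [∀ i, Module R (P i)]
    (d : ∀ i, P (i + 1) →ₗ[R] P i) (hP : ∀ i, Module.Projective R (P i))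
    (hd : ∀ i, Function.Exact (d (i + 1)) (d i)) (m j : ℕ)
    (hfin : ∀ i < m, Module.Finite R (P (j + 2 + i))) :
    HasFreePartialResolution R m (LinearMap.ker (d j)) := by
  induction m generalizing j with
  | zero => exact zero
  | succ m ih =>
    have := hP (j + 2)
    have := hfin 0 m.succ_pos
    refine ker_succ_of_exact _ _ (hd j) (ih (j + 1) fun i hi => ?_)
    have := hfin (i + 1) (by omega)
    rwa [show j + 2 + (i + 1) = j + 1 + 2 + i by omega] at this

theorem of_isOfTypeFP {M : Type v} [AddCommGroup M] [Module R M] {n : ℕ}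
    (h : Module.IsOfTypeFP R M n) : HasFreePartialResolution R (n + 1) M := by
  obtain ⟨P, _, _, d, ε, hP, hε, hdε, hd, hfin⟩ := h
  have := hP 0
  have := hfin 0 n.zero_le
  refine succ_of_projective ε hε ?_
  cases n with
  | zero => exact zero
  | succ n =>
    have := hP 1
    have := hfin 1 (by omega)
    exact ker_succ_of_exact _ _ hdε (ker_of_exact_seq d hP hd n 0 fun i hi => hfin _ (by omega))

/-- Free covers with finite source can be chosen in any large enough universe. -/
theorem exists_free_cover {n : ℕ} {M : Type*} [AddCommGroup M] [Module R M]
    (h : HasFreePartialResolution R (n + 1) M) :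
    ∃ (F : Type (max u v)) (_ : AddCommGroup F) (_ : Module R F) (f : F →ₗ[R] M),
      Module.Free R F ∧ Module.Finite R F ∧ Function.Surjective f ∧
        HasFreePartialResolution R n (LinearMap.ker f) := by
  obtain ⟨k, f, hf, hK⟩ := succ_iff.mp h
  let e : ULift.{v} (Fin k → R) ≃ₗ[R] (Fin k → R) := ULift.moduleEquiv
  exact ⟨ULift.{v} (Fin k → R), inferInstance, inferInstance, f ∘ₗ e.toLinearMap,
    .of_equiv e.symm, .equiv e.symm, hf.comp e.surjective, hK.ker_comp_equiv e⟩

theorem exists_projective_cover {n : ℕ} {M : Type (max u v)} [AddCommGroup M] [Module R M]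
    (h : HasFreePartialResolution R n M) :
    ∃ (P : Type (max u v)) (_ : AddCommGroup P) (_ : Module R P) (f : P →ₗ[R] M),
      Module.Projective R P ∧ (0 < n → Module.Finite R P) ∧ Function.Surjective f ∧
        HasFreePartialResolution R (n - 1) (LinearMap.ker f) := by
  cases n with
  -- No finiteness is demanded any more, so the free module on the underlying set of `M` serves.
  | zero =>
    exact ⟨M →₀ R, inferInstance, inferInstance, Finsupp.linearCombination R id, inferInstance,
      fun h => absurd h (lt_irrefl 0), Finsupp.linearCombination_id_surjective R M, zero⟩
  | succ n =>
    obtain ⟨F, _, _, f, _, hF, hf, hK⟩ := exists_free_cover.{u, v} h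
    exact ⟨F, _, _, f, inferInstance, fun _ => hF, hf, hK⟩

/-- A module together with a bound for the number of finite free modules in a partial resolution,
the state of the recursion that builds a projective resolution. -/
structure Syzygy (R : Type u) [Ring R] where
  length : ℕ
  carrier : ModuleCat.{max u v} R
  hasFreePartialResolution : HasFreePartialResolution R length carrier

namespace Syzygy

variable (X : Syzygy.{u, v} R)

/-- The chosen projective cover of a syzygy. -/
noncomputable def cover : ModuleCat.{max u v} R :=
  letI := (exists_projective_cover.{u, v} X.hasFreePartialResolution).choose_spec.choose
  letI := (exists_projective_cover.{u, v} X.hasFreePartialResolution).choose_spec.choose_spec.choose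
  ModuleCat.of R (exists_projective_cover.{u, v} X.hasFreePartialResolution).choose

theorem exists_map : ∃ f : X.cover →ₗ[R] X.carrier, Module.Projective R X.cover ∧
    (0 < X.length → Module.Finite R X.cover) ∧ Function.Surjective f ∧
      HasFreePartialResolution R (X.length - 1) (LinearMap.ker f) :=
  (exists_projective_cover.{u, v} X.hasFreePartialResolution).choose_spec.choose_spec.choose_spec

/-- The chosen surjection from the projective cover of a syzygy. -/
noncomputable def map : X.cover →ₗ[R] X.carrier := X.exists_map.choose

/-- The kernel of the chosen projective cover. -/
noncomputable def next : Syzygy.{u, v} R :=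
  -- The subtraction is truncated: once the length reaches `0`, the resolution continues with covers
  -- that need not be finite.
  ⟨X.length - 1, ModuleCat.of R (LinearMap.ker X.map), X.exists_map.choose_spec.2.2.2⟩

/-- The sequence of iterated syzygies. -/
noncomputable def iter : ℕ → Syzygy.{u, v} R
  | 0 => X
  | i + 1 => (iter i).next

theorem length_iter (i : ℕ) : (X.iter i).length = X.length - i := by
  induction i with
  | zero => rfl
  | succ i ih =>
    change (X.iter i).length - 1 = _
    omega

/-- The differentials of the projective resolution built from iterated syzygies. -/
noncomputable def d (i : ℕ) : (X.iter (i + 1)).cover →ₗ[R] (X.iter i).cover :=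
  (LinearMap.ker (X.iter i).map).subtype ∘ₗ (X.iter (i + 1)).map

theorem map_surjective : Function.Surjective X.map := X.exists_map.choose_spec.2.2.1

theorem exact_d_map (i : ℕ) : Function.Exact (X.d i) (X.iter i).map := by
  intro y
  constructor
  · intro hy
    obtain ⟨x, hx⟩ := (X.iter (i + 1)).map_surjective ⟨y, hy⟩
    exact ⟨x, congrArg Subtype.val hx⟩
  · rintro ⟨x, rfl⟩
    exact ((X.iter (i + 1)).map x).2

theorem exact_d_d (i : ℕ) : Function.Exact (X.d (i + 1)) (X.d i) := by
  intro y
  rw [← X.exact_d_map (i + 1) y]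
  exact (Submodule.coe_eq_zero (x := (X.iter (i + 1)).map y))

end Syzygy

theorem isOfTypeFP {M : Type v} [AddCommGroup M] [Module R M] {n : ℕ}
    (h : HasFreePartialResolution R (n + 1) M) : Module.IsOfTypeFP R M n := by
  let e : ULift.{u} M ≃ₗ[R] M := ULift.moduleEquiv
  let X : Syzygy.{u, v} R := ⟨n + 1, ModuleCat.of R (ULift.{u} M), h.congr e.symm⟩
  refine ⟨fun i => (X.iter i).cover, inferInstance, inferInstance, X.d,
    e.toLinearMap ∘ₗ X.map, fun i => (X.iter i).exists_map.choose_spec.1,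
    e.surjective.comp X.map_surjective, fun y => ?_, X.exact_d_d,
    fun i hi => (X.iter i).exists_map.choose_spec.2.1 ?_⟩
  · rw [← X.exact_d_map 0 y]
    exact e.map_eq_zero_iff
  · rw [X.length_iter]
    exact Nat.sub_pos_of_lt (Nat.lt_succ_of_le hi)

end Module.HasFreePartialResolution

/-! ### Modules induced along a ring homomorphism. -/

section Induced

variable {R : Type*} {T : Type*} [Ring R] [Ring T] {σ : R →+* T} {ι : Type*}
variable {N : Type*} [AddCommGroup N] [Module R N] {N' : Type*} [AddCommGroup N'] [Module R N']
variable {M : Type*} [AddCommGroup M] [Module T M] {M' : Type*} [AddCommGroup M'] [Module T M']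

/-- The coordinatewise application of a semilinear map. -/
def LinearMap.piConst (k : ℕ) (i : N →ₛₗ[σ] M) : (Fin k → N) →ₛₗ[σ] (Fin k → M) where
  toFun x j := i (x j)
  map_add' _ _ := funext fun _ => i.map_add _ _
  map_smul' _ _ := funext fun _ => i.map_smulₛₗ _ _

@[simp]
theorem LinearMap.piConst_apply (k : ℕ) (i : N →ₛₗ[σ] M) (x : Fin k → N) (j : Fin k) :
    i.piConst k x j = i (x j) := rfl

theorem LinearMap.piConst_bijective (k : ℕ) {i : N →ₛₗ[σ] M} (hi : Function.Bijective i) :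
    Function.Bijective (i.piConst k) :=
  ⟨fun _ _ h => funext fun j => hi.1 (congrFun h j), fun y =>
    ⟨fun j => (hi.2 (y j)).choose, funext fun j => (hi.2 (y j)).choose_spec⟩⟩

/-- The map `(x c) ↦ ∑ c, s c • i (x c)`. -/
noncomputable def LinearMap.twistedSum (s : ι → T) (i : N →ₛₗ[σ] M) : (ι →₀ N) →+ M :=
  Finsupp.liftAddHom fun c => (DistribSMul.toAddMonoidHom M (s c)).comp i.toAddMonoidHom

@[simp]
theorem LinearMap.twistedSum_single (s : ι → T) (i : N →ₛₗ[σ] M) (c : ι) (x : N) :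
    i.twistedSum s (Finsupp.single c x) = s c • i x := by
  simp [LinearMap.twistedSum]

/-- The `T`-module `M` is the direct sum of the translates `s c • i N`. If `σ : R →+* T` itself has
this property, then this says that `M` is induced from `N` along `σ`. -/
def LinearMap.IsInduced (s : ι → T) (i : N →ₛₗ[σ] M) : Prop :=
  Function.Bijective (i.twistedSum s)

/-- Naturality of `twistedSum`; most of the properties of induced modules are read off from this
square. -/
theorem LinearMap.twistedSum_mapRange (s : ι → T) (i : N →ₛₗ[σ] M) (i' : N' →ₛₗ[σ] M')
    (f : M →ₗ[T] M') (g : N →ₗ[R] N') (h : ∀ x, f (i x) = i' (g x)) (x : ι →₀ N) :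
    i'.twistedSum s (Finsupp.mapRange g g.map_zero x) = f (i.twistedSum s x) := by
  induction x using Finsupp.induction_linear with
  | zero => simp
  | add x y hx hy => rw [Finsupp.mapRange_add g.map_add, map_add, hx, hy, map_add, map_add]
  | single c x => simp [h]

namespace LinearMap.IsInduced

variable {s : ι → T}

theorem pi {i : N →ₛₗ[σ] M} (hi : i.IsInduced s) (k : ℕ) : (i.piConst k).IsInduced s := by
  constructor
  · rw [injective_iff_map_eq_zero]
    intro x hx
    ext c j
    have h := twistedSum_mapRange s (i.piConst k) i (LinearMap.proj j) (LinearMap.proj j)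
      (fun _ => rfl) x
    rw [hx, map_zero, map_eq_zero_iff _ hi.1] at h
    exact DFunLike.congr_fun h c
  · intro y
    choose x hx using fun j => hi.2 (y j)
    refine ⟨∑ j, Finsupp.mapRange (LinearMap.single R (fun _ => N) j) (map_zero _) (x j), ?_⟩
    rw [map_sum, ← Finset.univ_sum_single y]
    refine Finset.sum_congr rfl fun j _ => ?_
    rw [twistedSum_mapRange s i (i.piConst k) (LinearMap.single T (fun _ => M) j)
      (LinearMap.single R (fun _ => N) j), hx]
    · rfl
    · intro z
      ext l
      by_cases h : l = j
      · subst h; simp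
      · simp [h]

/-- Induction is exact, because it is a direct sum of copies of `N` on which `q` acts through `p`
coordinatewise. -/
theorem ker {i : N →ₛₗ[σ] M} {i' : N' →ₛₗ[σ] M'} (hi : i.IsInduced s) (hi' : i'.IsInduced s)
    (p : N →ₗ[R] N') (q : M →ₗ[T] M') (h : ∀ x, q (i x) = i' (p x)) :
    (i.kerMap p q fun x hx => by rw [h, hx, map_zero]).IsInduced s := by
  have key := twistedSum_mapRange s (i.kerMap p q fun x hx => by rw [h, hx, map_zero]) i
    (LinearMap.ker q).subtype (LinearMap.ker p).subtype (fun _ => rfl)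
  constructor
  · rw [injective_iff_map_eq_zero]
    intro x hx
    have h1 := key x
    rw [hx, map_zero, map_eq_zero_iff _ hi.1] at h1
    ext c
    exact DFunLike.congr_fun h1 c
  · intro y
    obtain ⟨x, hx⟩ := hi.2 y
    have h1 := twistedSum_mapRange s i i' q p h x
    rw [hx, LinearMap.map_coe_ker, map_eq_zero_iff _ hi'.1] at h1
    classical
    -- Only a set-theoretic retraction is needed: all coordinates of `x` lie in `ker p`, so the
    -- default value `0` never matters.
    let r : N → LinearMap.ker p := fun n => if hn : p n = 0 then ⟨n, hn⟩ else 0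
    refine ⟨Finsupp.mapRange r (dif_pos p.map_zero) x, Subtype.ext ?_⟩
    refine (key _).symm.trans ((congrArg _ ?_).trans hx)
    ext c
    have hc : p (x c) = 0 := DFunLike.congr_fun h1 c
    simp [r, hc]

theorem comp_equiv {i : N →ₛₗ[σ] M} (hi : i.IsInduced s) (e : M ≃ₗ[T] M') :
    (e.toLinearMap.comp i).IsInduced s := by
  have h : ∀ x, (e.toLinearMap.comp i).twistedSum s x = e (i.twistedSum s x) := fun x => by
    have := twistedSum_mapRange s i (e.toLinearMap.comp i) e.toLinearMap LinearMap.id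
      (fun _ => rfl) x
    rwa [show Finsupp.mapRange (LinearMap.id : N →ₗ[R] N) (map_zero _) x = x from
      Finsupp.ext fun _ => rfl] at this
  rw [LinearMap.IsInduced, show ⇑((e.toLinearMap.comp i).twistedSum s) = e ∘ i.twistedSum s from
    funext h]
  exact e.bijective.comp hi

theorem equiv_comp {i : N →ₛₗ[σ] M} (hi : i.IsInduced s) (e : N' ≃ₗ[R] N) :
    (i.comp e.toLinearMap).IsInduced s := by
  have h : ∀ x, (i.comp e.toLinearMap).twistedSum s x =
      i.twistedSum s (Finsupp.mapRange.addEquiv e.toAddEquiv x) :=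
    fun x => (twistedSum_mapRange s (i.comp e.toLinearMap) i LinearMap.id e.toLinearMap
      (fun _ => rfl) x).symm
  rw [LinearMap.IsInduced, show ⇑((i.comp e.toLinearMap).twistedSum s) =
    i.twistedSum s ∘ Finsupp.mapRange.addEquiv e.toAddEquiv from funext h]
  exact hi.comp (AddEquiv.bijective _)

theorem surjective_of_comp {i : N →ₛₗ[σ] M} {i' : N' →ₛₗ[σ] M'} (hi' : i'.IsInduced s)
    (p : N →ₗ[R] N') (q : M →ₗ[T] M') (h : ∀ x, q (i x) = i' (p x))
    (hp : Function.Surjective p) : Function.Surjective q := by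
  intro y
  obtain ⟨x, rfl⟩ := hi'.2 y
  obtain ⟨z, rfl⟩ := Finsupp.mapRange_surjective p p.map_zero hp x
  exact ⟨_, (twistedSum_mapRange s i i' q p h z).symm⟩

theorem span_range_eq_top {i : N →ₛₗ[σ] M} (hi : i.IsInduced s) :
    Submodule.span T (Set.range i) = ⊤ := by
  rw [eq_top_iff]
  rintro y -
  obtain ⟨x, rfl⟩ := hi.2 y
  induction x using Finsupp.induction_linear with
  | zero => simp
  | add x y hx hy => rw [map_add]; exact add_mem hx hy
  | single c x =>
    rw [twistedSum_single]
    exact Submodule.smul_mem _ _ (Submodule.subset_span ⟨x, rfl⟩)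

end LinearMap.IsInduced

/-- A semilinear map out of a finite free module over `R` extends to the finite free module over
`T` of the same rank. -/
theorem LinearMap.exists_extension_piConst {k : ℕ} (f : (Fin k → R) →ₛₗ[σ] M) :
    ∃ F : (Fin k → T) →ₗ[T] M, ∀ x, F (σ.toSemilinearMap.piConst k x) = f x := by
  refine ⟨Fintype.linearCombination T fun j => f (Pi.single j 1), fun x => ?_⟩
  rw [Fintype.linearCombination_apply]
  conv_rhs => rw [pi_eq_sum_univ' x, map_sum]
  refine Finset.sum_congr rfl fun j _ => ?_
  rw [map_smulₛₗ]
  congr 2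

end Induced

/-! ### Partial resolutions under induction and change of rings. -/

namespace Module.HasFreePartialResolution

section Induced

variable {R : Type u} {T : Type v} [Ring R] [Ring T] {σ : R →+* T} {ι : Type*} {s : ι → T} {n : ℕ}
variable {N : Type*} [AddCommGroup N] [Module R N] {M : Type*} [AddCommGroup M] [Module T M]

/-- A free cover of `N` extends to a free cover of `M`, and by exactness its kernel is induced from
the kernel of the original cover. -/
theorem of_isInduced_step (hs : σ.toSemilinearMap.IsInduced s)
    (ih : ∀ (K : Type u) (L : Type v) [AddCommGroup K] [Module R K] [AddCommGroup L] [Module T L]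
      (i : K →ₛₗ[σ] L), i.IsInduced s →
      HasFreePartialResolution R n K → HasFreePartialResolution T n L)
    {i : N →ₛₗ[σ] M} (hi : i.IsInduced s) (h : HasFreePartialResolution R (n + 1) N) :
    HasFreePartialResolution T (n + 1) M := by
  obtain ⟨k, f, hf, hK⟩ := succ_iff.mp h
  obtain ⟨F, hF⟩ := LinearMap.exists_extension_piConst (i.comp f)
  exact succ_iff.mpr ⟨k, F, hi.surjective_of_comp f F hF hf,
    ih _ _ _ ((hs.pi k).ker hi f F hF) hK⟩

/-- Modules induced from modules of type `FP_n` are of type `FP_n`. -/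
theorem of_isInduced (hs : σ.toSemilinearMap.IsInduced s)
    {i : N →ₛₗ[σ] M} (hi : i.IsInduced s) (h : HasFreePartialResolution R n N) :
    HasFreePartialResolution T n M := by
  have key (n : ℕ) : ∀ (K : Type u) (L : Type v) [AddCommGroup K] [Module R K] [AddCommGroup L]
      [Module T L] (i : K →ₛₗ[σ] L), i.IsInduced s →
      HasFreePartialResolution R n K → HasFreePartialResolution T n L := by
    induction n with
    | zero => intros; exact zero
    | succ n ih => intro K L _ _ _ _ i hi; exact of_isInduced_step hs ih hi
  cases n with
  | zero => exact zero
  | succ n => exact of_isInduced_step hs (key n) hi h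

end Induced

section ChangeOfRings

variable {T : Type v} {U : Type u} [Ring T] [Ring U] {π : T →+* U} {n : ℕ}
variable {M : Type*} [AddCommGroup M] [Module T M] {L : Type*} [AddCommGroup L] [Module U L]

/-- A linear map between modules over `U`, transported to the restricted modules over `T`. -/
theorem _root_.LinearMap.exists_conj_of_bijective {M' : Type*} [AddCommGroup M'] [Module T M']
    {L' : Type*} [AddCommGroup L'] [Module U L'] (e' : M' →ₛₗ[π] L') (e : M →ₛₗ[π] L)
    (he : Function.Bijective e) (f : L' →ₗ[U] L) :
    ∃ F : M' →ₗ[T] M, ∀ x, e (F x) = f (e' x) := by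
  choose F hF using fun x => he.2 (f (e' x))
  exact ⟨{ toFun := F
           map_add' := fun x y => he.1 (by simp only [hF, map_add])
           map_smul' := fun r x => he.1 (by simp only [hF, map_smulₛₗ, RingHom.id_apply]) }, hF⟩

theorem _root_.LinearMap.kerMap_bijective {M' : Type*} [AddCommGroup M'] [Module T M']
    {L' : Type*} [AddCommGroup L'] [Module U L'] {e' : M' →ₛₗ[π] L'}
    (he' : Function.Bijective e') {e : M →ₛₗ[π] L} (he : Function.Bijective e)
    (F : M' →ₗ[T] M) (f : L' →ₗ[U] L) (h : ∀ x, e (F x) = f (e' x)) :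
    Function.Bijective (e'.kerMap F f fun x hx => by rw [← h, hx, map_zero]) := by
  constructor
  · intro x y hxy
    exact Subtype.ext (he'.1 (Subtype.ext_iff.mp hxy))
  · intro y
    obtain ⟨x, hx⟩ := he'.2 y
    exact ⟨⟨x, he.1 (by rw [h, hx, y.2, map_zero])⟩, Subtype.ext hx⟩

theorem _root_.LinearMap.surjective_of_conj {M' : Type*} [AddCommGroup M'] [Module T M']
    {L' : Type*} [AddCommGroup L'] [Module U L'] {e' : M' →ₛₗ[π] L'}
    (he' : Function.Bijective e') {e : M →ₛₗ[π] L} (he : Function.Bijective e)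
    (F : M' →ₗ[T] M) (f : L' →ₗ[U] L) (h : ∀ x, e (F x) = f (e' x))
    (hf : Function.Surjective f) : Function.Surjective F := by
  intro y
  obtain ⟨z, hz⟩ := hf (e y)
  obtain ⟨x, rfl⟩ := he'.2 z
  exact ⟨x, he.1 ((h x).trans hz)⟩

/-- A cover by `U^k` becomes over `T` a cover by `V^k`, whose resolution is known, so `of_quotient`
applies. -/
theorem of_ringHom_step {V : Type w} [AddCommGroup V] [Module T V] (e₀ : V →ₛₗ[π] U)
    (he₀ : Function.Bijective e₀) (hV : HasFreePartialResolution T (n + 1) V)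
    (ih : ∀ (M : Type w) (L : Type u) [AddCommGroup M] [Module T M] [AddCommGroup L] [Module U L]
      (e : M →ₛₗ[π] L), Function.Bijective e →
      HasFreePartialResolution U n L → HasFreePartialResolution T n M)
    {e : M →ₛₗ[π] L} (he : Function.Bijective e) (h : HasFreePartialResolution U (n + 1) L) :
    HasFreePartialResolution T (n + 1) M := by
  obtain ⟨k, f, hf, hK⟩ := succ_iff.mp h
  have he' := LinearMap.piConst_bijective k he₀
  obtain ⟨F, hF⟩ := LinearMap.exists_conj_of_bijective (e₀.piConst k) e he f
  exact of_quotient F (LinearMap.surjective_of_conj he' he F f hF hf)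
    (ih _ _ _ (LinearMap.kerMap_bijective he' he F f hF) hK) (hV.pi k)

/-- If `U` is of type `FP_n` over `T`, then so is every `U`-module of type `FP_n`. -/
theorem of_ringHom {V : Type w} [AddCommGroup V] [Module T V] (e₀ : V →ₛₗ[π] U)
    (he₀ : Function.Bijective e₀) (hV : HasFreePartialResolution T n V)
    {e : M →ₛₗ[π] L} (he : Function.Bijective e) (h : HasFreePartialResolution U n L) :
    HasFreePartialResolution T n M := by
  have key (n : ℕ) (hV : HasFreePartialResolution T n V) : ∀ (M : Type w) (L : Type u)
      [AddCommGroup M] [Module T M] [AddCommGroup L] [Module U L]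
      (e : M →ₛₗ[π] L), Function.Bijective e →
      HasFreePartialResolution U n L → HasFreePartialResolution T n M := by
    induction n with
    | zero => intros; exact zero
    | succ n ih =>
      intro M L _ _ _ _ e he
      exact of_ringHom_step e₀ he₀ hV (ih hV.of_succ) he
  cases n with
  | zero => exact zero
  | succ n => exact of_ringHom_step e₀ he₀ hV (key n hV.of_succ) he h

end ChangeOfRings

end Module.HasFreePartialResolution

/-! ### Gaining one degree from a factorization. -/

theorem LinearMap.fg_span_range {R T N M : Type*} [Ring R] [Ring T] {σ : R →+* T}
    [AddCommGroup N] [Module R N] [Module.Finite R N] [AddCommGroup M] [Module T M]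
    (f : N →ₛₗ[σ] M) : (Submodule.span T (Set.range f)).FG := by
  classical
  obtain ⟨G, hG⟩ := Module.Finite.fg_top (R := R) (M := N)
  refine ⟨G.image f, le_antisymm (Submodule.span_mono ?_) (Submodule.span_le.mpr ?_)⟩
  · rw [Finset.coe_image]
    exact Set.image_subset_range _ _
  · rintro _ ⟨x, rfl⟩
    have hx : x ∈ Submodule.span R (G : Set N) := hG ▸ Submodule.mem_top
    induction hx using Submodule.span_induction with
    | mem x hx => exact Submodule.subset_span (by simpa using ⟨x, hx, rfl⟩)
    | zero => simp
    | add x y _ _ hx hy => rw [map_add]; exact add_mem hx hy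
    | smul r x _ hx => rw [map_smulₛₗ]; exact Submodule.smul_mem _ _ hx

namespace Module.HasFreePartialResolution

theorem of_finite {R M : Type*} [Ring R] [AddCommGroup M] [Module R M] [Module.Finite R M] :
    HasFreePartialResolution R 1 M := by
  obtain ⟨k, f, hf⟩ := Module.Finite.exists_fin' R M
  exact succ_iff.mpr ⟨k, f, hf, zero⟩

theorem finite {R M : Type*} [Ring R] [AddCommGroup M] [Module R M] {n : ℕ}
    (h : HasFreePartialResolution R (n + 1) M) : Module.Finite R M := by
  obtain ⟨k, f, hf, -⟩ := succ_iff.mp h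
  exact Module.Finite.of_surjective f hf

variable {R : Type u} {R₀ : Type w} {T : Type v} [Ring R] [Ring R₀] [Ring T]
  {σ₀ : R →+* R₀} {θ : R₀ →+* T} {σ : R →+* T} [RingHomCompTriple σ₀ θ σ]
  {ι : Type*} {s : ι → T}

/-- Let `M₀` be induced from an `R`-module `N`, and let `M` be a quotient of `M₀ × P` with `P`
finite projective. Suppose that the composite `N → M₀ → M` factors, up to a map that factors through
a finite projective `R`-module `W`, through an `R₀`-module `N₀` that has a longer partial
resolution. Then `M` has a longer partial resolution as well. -/
theorem of_factorization (hs : σ.toSemilinearMap.IsInduced s) (n : ℕ) :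
    ∀ {N W : Type u} {N₀ : Type w} {M₀ M : Type (max v t)} {P : Type v}
      [AddCommGroup N] [Module R N] [AddCommGroup W] [Module R W]
      [AddCommGroup N₀] [Module R₀ N₀] [AddCommGroup M₀] [Module T M₀]
      [AddCommGroup M] [Module T M] [AddCommGroup P] [Module T P]
      [Module.Projective R W] [Module.Finite R W] [Module.Projective T P] [Module.Finite T P]
      (i : N →ₛₗ[σ] M₀) (p : M₀ →ₗ[T] M) (p' : P →ₗ[T] M)
      (a : N →ₛₗ[σ₀] N₀) (b : N₀ →ₛₗ[θ] M) (c : N →ₗ[R] W) (d : W →ₛₗ[σ] M),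
      HasFreePartialResolution R n N → HasFreePartialResolution R₀ (n + 1) N₀ → i.IsInduced s →
      Function.Surjective (p.coprod p') →
      HasFreePartialResolution T n (LinearMap.ker (p.coprod p')) →
      (∀ x, p (i x) = b (a x) + d (c x)) →
      HasFreePartialResolution T (n + 1) M := by
  induction n with
  | zero =>
    intro N W N₀ M₀ M P _ _ _ _ _ _ _ _ _ _ _ _ _ _ _ _ i p p' a b c d _ hN₀ hi hp _ h
    have := hN₀.finite
    -- The factorization puts the image of `N`, and hence that of `M₀`, which it generates, into
    -- this finitely generated submodule.
    let E := LinearMap.range p' ⊔ Submodule.span T (Set.range b) ⊔ Submodule.span T (Set.range d)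
    have hE : E.FG :=
      ((LinearMap.range_eq_map p' ▸ Module.Finite.fg_top.map p').sup b.fg_span_range).sup
        d.fg_span_range
    have hpE : ∀ m, p m ∈ E := by
      intro m
      have hm : m ∈ Submodule.span T (Set.range i) := hi.span_range_eq_top ▸ Submodule.mem_top
      refine (Submodule.span_le (p := E.comap p)).mpr ?_ hm
      rintro _ ⟨x, rfl⟩
      change p (i x) ∈ E
      rw [h]
      exact add_mem
        (Submodule.mem_sup_left (Submodule.mem_sup_right (Submodule.subset_span ⟨_, rfl⟩)))
        (Submodule.mem_sup_right (Submodule.subset_span ⟨_, rfl⟩))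
    have hE_top : E = ⊤ := by
      rw [eq_top_iff]
      rintro m -
      obtain ⟨⟨x, y⟩, rfl⟩ := hp m
      exact add_mem (hpE x) (Submodule.mem_sup_left (Submodule.mem_sup_left ⟨y, rfl⟩))
    have : Module.Finite T M := ⟨hE_top ▸ hE⟩
    exact of_finite
  | succ n ih =>
    intro N W N₀ M₀ M P _ _ _ _ _ _ _ _ _ _ _ _ _ _ _ _ i p p' a b c d hN hN₀ hi hp hK h
    obtain ⟨k, f, hf, hfK⟩ := succ_iff.mp hN
    obtain ⟨k₀, f₀, hf₀, hf₀K⟩ := succ_iff.mp hN₀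
    obtain ⟨l, q, hq, hqK⟩ := succ_iff.mp hK
    obtain ⟨F', hF'⟩ := LinearMap.exists_extension_piConst (i.comp f)
    let e : ULift.{t} (Fin k → T) ≃ₗ[T] (Fin k → T) := ULift.moduleEquiv
    have : Module.Projective T (ULift.{t} (Fin k → T)) := .of_equiv e.symm
    have : Module.Finite T (ULift.{t} (Fin k → T)) := .equiv e.symm
    let I := e.symm.toLinearMap.comp (σ.toSemilinearMap.piConst k)
    let F := F' ∘ₗ e.toLinearMap
    have hI : I.IsInduced s := (hs.pi k).comp_equiv e.symm
    have hF (x) : F (I x) = i (f x) := hF' x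
    have hF_surj : Function.Surjective F := hi.surjective_of_comp f F hF hf
    let r : (ULift.{t} (Fin k → T) × P) →ₗ[T] (M₀ × P) := F.prodMap LinearMap.id
    have hr : Function.Surjective r := hF_surj.prodMap Function.surjective_id
    let g := (p.coprod p') ∘ₗ r
    have hg : Function.Surjective g := hp.comp hr
    have hg_inl (x) : g (x, 0) = p (F x) := by simp [g, r]
    refine succ_of_projective g hg ?_
    obtain ⟨a', ha'⟩ := Module.Projective.exists_semilinear_lift f₀ hf₀ (a.comp f)
    obtain ⟨b', hb'⟩ := Module.Projective.exists_semilinear_lift g hg (b.comp f₀)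
    obtain ⟨d', hd'⟩ := Module.Projective.exists_semilinear_lift g hg d
    -- In the next stage `M₀`, `M` and `P` become `ker F`, `ker g` and `T^l`. Since `0 → ker F → ker
    -- g → ker (p.coprod p') → 0` is exact, lifting the cover `q` to `j` makes `ker F × T^l` cover
    -- `ker g`.
    obtain ⟨j, hj⟩ := Module.projective_lifting_property r
      ((LinearMap.ker (p.coprod p')).subtype ∘ₗ q) hr
    replace hj (y) : r (j y) = q y := LinearMap.congr_fun hj y
    have hgj (y) : g (j y) = 0 := (congrArg _ (hj y)).trans (q y).2
    -- The error of the lifted factorization. It takes values in `ker g` and is defined on all of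
    -- `R^k`, so on `ker f` it factors through a finite free module, the new `W`.
    let D₀ : (Fin k → R) →ₛₗ[σ] (ULift.{t} (Fin k → T) × P) :=
      (LinearMap.inl T _ P).comp I - b'.comp a' - d'.comp (c ∘ₗ f)
    have hD₀ (x) : D₀ x = (I x, 0) - b' (a' x) - d' (c (f x)) := rfl
    let D : (Fin k → R) →ₛₗ[σ] LinearMap.ker g := D₀.codRestrict _ fun x => by
      rw [LinearMap.mem_ker, hD₀, map_sub, map_sub, hg_inl, hF, hb', hd', h, LinearMap.comp_apply,
        ha', LinearMap.comp_apply]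
      abel
    let p₁ := (LinearMap.inl T (ULift.{t} (Fin k → T)) P).kerMap F g fun x hx => by
      rw [LinearMap.inl_apply, hg_inl, hx, map_zero]
    let j₁ := j.codRestrict (LinearMap.ker g) hgj
    have hpj (x y) : ((p₁.coprod j₁ (x, y) : LinearMap.ker g) : _ × P) = (x.1, 0) + j y := rfl
    refine ih (I.kerMap f F fun x hx => by rw [hF, hx, map_zero]) p₁ j₁
      (a'.kerMap f f₀ fun x hx => by rw [ha', LinearMap.comp_apply, hx, map_zero])
      (b'.kerMap f₀ g fun x hx => by rw [hb', LinearMap.comp_apply, hx, map_zero])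
      (LinearMap.ker f).subtype D hfK hf₀K (hI.ker hi f F hF) ?_ ?_ ?_
    · rintro ⟨z, hz⟩
      obtain ⟨y, hy⟩ := hq ⟨r z, hz⟩
      have hjy : r (z - j y) = 0 := by rw [map_sub, hj, hy, sub_self]
      have h1 : F (z - j y).1 = 0 := congrArg Prod.fst hjy
      have h2 : (z - j y).2 = 0 := congrArg Prod.snd hjy
      refine ⟨(⟨(z - j y).1, h1⟩, y), Subtype.ext ?_⟩
      rw [hpj, ← h2]
      exact sub_add_cancel z (j y)
    · have hker (y) (hy : q y = 0) : F (j y).1 = 0 ∧ (j y).2 = 0 := by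
        have := hj y
        rw [hy] at this
        exact ⟨congrArg Prod.fst this, congrArg Prod.snd this⟩
      -- The kernel of the new cover is a copy of `ker q`: if `q y = 0`, then `j y` has second
      -- component `0`, and its first component must be cancelled by an element of `ker F`.
      let m : LinearMap.ker q →ₗ[T] LinearMap.ker F :=
        (-(LinearMap.fst T _ P ∘ₗ j)).kerMap q F fun y hy =>
          (map_neg F (j y).1).trans (neg_eq_zero.mpr (hker y hy).1)
      refine of_exact_left (m.prod (LinearMap.ker q).subtype) _
        (fun x y hxy => Subtype.ext (congrArg Prod.snd hxy)) (fun z => ?_) hqK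
      obtain ⟨x, y⟩ := z
      rw [← Submodule.coe_eq_zero, hpj]
      constructor
      · intro hxy
        have h1 : x.1 + (j y).1 = 0 := congrArg Prod.fst hxy
        have h2 : 0 + (j y).2 = 0 := congrArg Prod.snd hxy
        have hy : q y = 0 := by
          refine Subtype.ext ((hj y).symm.trans (Prod.ext ?_ ?_))
          · change F (j y).1 = 0
            rw [← neg_eq_of_add_eq_zero_right h1, map_neg, x.2, neg_zero]
          · exact (zero_add _).symm.trans h2
        exact ⟨⟨y, hy⟩, Prod.ext (Subtype.ext (neg_eq_of_add_eq_zero_left h1)) rfl⟩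
      · rintro ⟨y', hy'⟩
        obtain rfl : y'.1 = y := congrArg Prod.snd hy'
        obtain rfl : m y' = x := congrArg Prod.fst hy'
        refine Prod.ext (neg_add_cancel _) ?_
        exact (zero_add _).trans (hker _ y'.2).2
    · intro x
      refine Subtype.ext ?_
      change ((I x, 0) : _ × P) = b' (a' x) + D₀ x
      rw [hD₀, show f x = 0 from x.2, map_zero, map_zero]
      abel

/-- The starting point of the induction: an exact factorization, with `P` and `W` trivial. The lifts
only align universes. -/
theorem of_comp_eq (hs : σ.toSemilinearMap.IsInduced s) {n : ℕ}
    {N N₀ : Type} [AddCommGroup N] [Module R N] [AddCommGroup N₀] [Module R₀ N₀]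
    {M₀ : Type t} [AddCommGroup M₀] [Module T M₀] {M : Type x} [AddCommGroup M] [Module T M]
    (i : N →ₛₗ[σ] M₀) (p : M₀ →ₗ[T] M) (a : N →ₛₗ[σ₀] N₀) (b : N₀ →ₛₗ[θ] M)
    (hN : HasFreePartialResolution R n N) (hN₀ : HasFreePartialResolution R₀ (n + 1) N₀)
    (hi : i.IsInduced s) (hp : Function.Surjective p)
    (hK : HasFreePartialResolution T n (LinearMap.ker p)) (h : ∀ x, p (i x) = b (a x)) :
    HasFreePartialResolution T (n + 1) M := by
  let eN : ULift.{u} N ≃ₗ[R] N := ULift.moduleEquiv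
  let eN₀ : ULift.{w} N₀ ≃ₗ[R₀] N₀ := ULift.moduleEquiv
  let eM₀ : ULift.{max v x} M₀ ≃ₗ[T] M₀ := ULift.moduleEquiv
  let eM : ULift.{max v t} M ≃ₗ[T] M := ULift.moduleEquiv
  let p₁ : ULift.{max v x} M₀ × PUnit.{v + 1} →ₗ[T] ULift.{max v t} M :=
    (eM.symm.toLinearMap ∘ₗ p ∘ₗ eM₀.toLinearMap).coprod 0
  let e : (ULift.{max v x} M₀ × PUnit.{v + 1}) ≃ₗ[T] M₀ :=
    LinearEquiv.prodUnique.trans eM₀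
  have hp₁ : p₁ = (eM.symm.toLinearMap ∘ₗ p) ∘ₗ e.toLinearMap :=
    LinearMap.ext fun _ => add_zero _
  refine congr eM (of_factorization.{u, v, w, max t x} (W := PUnit.{u + 1}) hs n
    (eM₀.symm.toLinearMap.comp (i.comp eN.toLinearMap))
    (eM.symm.toLinearMap ∘ₗ p ∘ₗ eM₀.toLinearMap) (0 : PUnit.{v + 1} →ₗ[T] _)
    (eN₀.symm.toLinearMap.comp (a.comp eN.toLinearMap))
    (eM.symm.toLinearMap.comp (b.comp eN₀.toLinearMap)) 0 0
    (hN.congr eN.symm) (hN₀.congr eN₀.symm) ((hi.equiv_comp eN).comp_equiv _) ?_ ?_ fun x => ?_)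
  · change Function.Surjective p₁
    rw [hp₁]
    exact (eM.symm.surjective.comp hp).comp e.surjective
  · change HasFreePartialResolution T n (LinearMap.ker p₁)
    rw [hp₁]
    refine ker_comp_equiv e _ ?_
    rwa [LinearEquiv.ker_comp]
  · rw [map_zero, add_zero]
    exact congrArg eM.symm (h _)

end Module.HasFreePartialResolution

/-! ### Group rings of a group extension. -/

section GroupRings

variable {G H : Type*} [Group G] [Group H]

open MonoidAlgebra

/-- The identity of `ℤ`, as a semilinear map between trivial modules over group rings. -/
noncomputable def Group.trivialMap (φ : G →* H) :
    (Representation.trivial ℤ G ℤ).asModule →ₛₗ[mapDomainRingHom ℤ φ]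
      (Representation.trivial ℤ H ℤ).asModule where
  toFun z := (Representation.trivial ℤ H ℤ).asModuleEquiv.symm
    ((Representation.trivial ℤ G ℤ).asModuleEquiv z)
  map_add' _ _ := rfl
  map_smul' r z := by
    induction r using MonoidAlgebra.induction_linear with
    | zero => simp
    | add r r' hr hr' => simp only [add_smul, map_add, hr, hr']
    | single g m =>
      rw [mapDomainRingHom_apply, mapDomain_single, Representation.single_smul,
        Representation.single_smul]
      rfl

theorem Group.trivialMap_bijective (φ : G →* H) : Function.Bijective (Group.trivialMap φ) :=
  Function.bijective_id

end GroupRings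

/-- The target ring of a ring homomorphism, as a module over the source. -/
def RingHom.RestrictedTarget {T U : Type*} [Ring T] [Ring U] (_ : T →+* U) : Type _ := U

namespace RingHom.RestrictedTarget

variable {T U : Type*} [Ring T] [Ring U] (π : T →+* U)

instance : AddCommGroup π.RestrictedTarget := inferInstanceAs (AddCommGroup U)

instance : Module T π.RestrictedTarget := Module.compHom U π

/-- The identity as a semilinear map. -/
def toTarget : π.RestrictedTarget →ₛₗ[π] U where
  toFun u := u
  map_add' _ _ := rfl
  map_smul' _ _ := rfl

theorem toTarget_bijective : Function.Bijective (toTarget π) := Function.bijective_id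

end RingHom.RestrictedTarget

namespace GroupExtension

open MonoidAlgebra RingHom.RestrictedTarget

variable {A B C : Type*} [Group A] [Group B] [Group C] (E : GroupExtension A B C)

/-- Coset representatives of the kernel, as elements of the group ring. -/
noncomputable def cosetRep (c : C) : MonoidAlgebra ℤ B :=
  single (Function.surjInv E.rightHom_surjective c) 1

/-- The decomposition of the middle group into cosets. -/
noncomputable def prodEquiv : C × A ≃ B :=
  Equiv.ofBijective (fun x => Function.surjInv E.rightHom_surjective x.1 * E.inl x.2) <| by
    constructor
    · rintro ⟨c, a⟩ ⟨c', a'⟩ h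
      have hc : c = c' := by
        simpa [Function.surjInv_eq] using congrArg E.rightHom h
      subst hc
      exact Prod.ext rfl (E.inl_injective (mul_left_cancel h))
    · intro b
      have hb : (Function.surjInv E.rightHom_surjective (E.rightHom b))⁻¹ * b ∈ E.inl.range := by
        rw [E.range_inl_eq_ker_rightHom, MonoidHom.mem_ker]
        simp [Function.surjInv_eq]
      obtain ⟨a, ha⟩ := hb
      exact ⟨(E.rightHom b, a), by simp [ha]⟩

theorem prodEquiv_apply (c : C) (a : A) :
    E.prodEquiv (c, a) = Function.surjInv E.rightHom_surjective c * E.inl a := rfl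

/-- The group ring of the middle group is free over the group ring of the kernel. -/
theorem isInduced_mapDomainRingHom :
    (mapDomainRingHom ℤ E.inl).toSemilinearMap.IsInduced E.cosetRep := by
  -- Currying along the coset decomposition `C × A ≃ B`.
  let e : (C →₀ MonoidAlgebra ℤ A) ≃+ MonoidAlgebra ℤ B :=
    (coeffAddEquiv.symm.trans curryAddEquiv.symm).trans (mapDomainAddEquiv ℤ E.prodEquiv)
  have he : (mapDomainRingHom ℤ E.inl).toSemilinearMap.twistedSum E.cosetRep =
      e.toAddMonoidHom := by
    refine Finsupp.addHom_ext fun c r => ?_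
    rw [LinearMap.twistedSum_single]
    induction r using MonoidAlgebra.induction_linear with
    | zero => simp
    | add r r' hr hr' => rw [Finsupp.single_add, map_add, map_add, smul_add, hr, hr']
    | single a m =>
      have h1 : coeffAddEquiv.symm (Finsupp.single c (single a m)) =
          single c (single a m) := rfl
      simp [e, h1, cosetRep, prodEquiv_apply, single_mul_single]
  rw [LinearMap.IsInduced, he]
  exact e.bijective

/-- The inclusion of `ℤ` into the group ring of the quotient, semilinear over the group ring of the
kernel. -/
noncomputable def trivialToQuotient : (Representation.trivial ℤ A ℤ).asModule
    →ₛₗ[mapDomainRingHom ℤ E.inl] (mapDomainRingHom ℤ E.rightHom).RestrictedTarget where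
  toFun z := (single 1 ((Representation.trivial ℤ A ℤ).asModuleEquiv z) : MonoidAlgebra ℤ C)
  map_add' _ _ := single_add ..
  map_smul' r z := by
    change (single 1 ((Representation.trivial ℤ A ℤ).asModuleEquiv (r • z)) : MonoidAlgebra ℤ C) =
      mapDomainRingHom ℤ E.rightHom (mapDomainRingHom ℤ E.inl r) *
        (single 1 ((Representation.trivial ℤ A ℤ).asModuleEquiv z) : MonoidAlgebra ℤ C)
    induction r using MonoidAlgebra.induction_linear with
    | zero => simp
    | add r r' hr hr' => simp only [add_smul, map_add, single_add, hr, hr', add_mul]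
    | single a m =>
      rw [Representation.single_smul]
      simp only [mapDomainRingHom_apply, mapDomain_single, rightHom_inl, single_mul_single, one_mul]
      rfl

/-- The representative of the coset `c` acts on `ℤC` as `c`, so the translates of `ℤ · 1` are the
lines `ℤ · c`. -/
theorem isInduced_trivialToQuotient : E.trivialToQuotient.IsInduced E.cosetRep := by
  let e : (C →₀ (Representation.trivial ℤ A ℤ).asModule) ≃+
      (mapDomainRingHom ℤ E.rightHom).RestrictedTarget :=
    (coeffAddEquiv (R := ℤ) (M := C)).symm
  have he : E.trivialToQuotient.twistedSum E.cosetRep = e.toAddMonoidHom := by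
    refine Finsupp.addHom_ext fun c z => ?_
    rw [LinearMap.twistedSum_single]
    change mapDomainRingHom ℤ E.rightHom (E.cosetRep c) * single 1 _ = single c _
    simp [cosetRep, single_mul_single, Function.surjInv_eq]
    rfl
  rw [LinearMap.IsInduced, he]
  exact e.bijective

end GroupExtension

open MonoidAlgebra Module.HasFreePartialResolution in
theorem theoremA {A B C B₀ C₀ : Type*} [Group A] [Group B] [Group C] [Group B₀] [Group C₀]
    (n : ℕ) (hn : 1 ≤ n)
    (E : GroupExtension A B C) (hA : Group.IsOfTypeFP A n) (hC : Group.IsOfTypeFP C (n + 1))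
    (E₀ : GroupExtension A B₀ C₀) (hB₀ : Group.IsOfTypeFP B₀ (n + 1))
    (θ : B₀ →* B) (hθ : ∀ a : A, θ (E₀.inl a) = E.inl a) :
    Group.IsOfTypeFP B (n + 1) := by
  replace hA := of_isOfTypeFP hA
  replace hB₀ := of_isOfTypeFP hB₀
  obtain ⟨k, f, hf, hK⟩ := succ_iff.mp (of_isOfTypeFP hC)
  have : RingHomCompTriple (mapDomainRingHom ℤ E₀.inl) (mapDomainRingHom ℤ θ)
      (mapDomainRingHom ℤ E.inl) :=
    ⟨by rw [← mapDomainRingHom_comp, show θ.comp E₀.inl = E.inl from MonoidHom.ext hθ]⟩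
  let π := mapDomainRingHom ℤ E.rightHom
  have he₀ := RingHom.RestrictedTarget.toTarget_bijective π
  have he₀k := LinearMap.piConst_bijective k he₀
  have he := Group.trivialMap_bijective E.rightHom
  obtain ⟨p, hp⟩ := LinearMap.exists_conj_of_bijective
    ((RingHom.RestrictedTarget.toTarget π).piConst k) _ he f
  -- On vectors with entries in `ℤ · 1`, the map `f` is the integer combination with coefficients `f
  -- (Pi.single j 1)`. For trivial actions this is linear over any group ring, in particular
  -- semilinear along `θ`.
  let b : (Fin k → (Representation.trivial ℤ B₀ ℤ).asModule) →ₛₗ[mapDomainRingHom ℤ θ]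
      (Representation.trivial ℤ B ℤ).asModule :=
    LinearMap.comp
      (∑ j, (Representation.trivial ℤ C ℤ).asModuleEquiv (f (Pi.single j 1)) •
        (LinearMap.proj j : (Fin k → (Representation.trivial ℤ B ℤ).asModule) →ₗ[MonoidAlgebra ℤ B]
          (Representation.trivial ℤ B ℤ).asModule))
      ((Group.trivialMap θ).piConst k)
  -- Here `of_comp_eq` is used with `n + 1` terms for `A` and for the kernel, and with `n + 2` terms
  -- for `B₀` and for the conclusion.
  refine isOfTypeFP (of_comp_eq E.isInduced_mapDomainRingHom (E.trivialToQuotient.piConst k) p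
    ((Group.trivialMap E₀.inl).piConst k) b (hA.pi k) (hB₀.pi k)
    (E.isInduced_trivialToQuotient.pi k) (LinearMap.surjective_of_conj he₀k he p f hp hf)
    (of_ringHom (RingHom.RestrictedTarget.toTarget π) he₀
      (of_isInduced E.isInduced_mapDomainRingHom E.isInduced_trivialToQuotient hA)
      (LinearMap.kerMap_bijective he₀k he p f hp) hK) fun x => ?_)
  refine he.1 ((hp _).trans ?_)
  have hx : (RingHom.RestrictedTarget.toTarget π).piConst k (E.trivialToQuotient.piConst k x) =
      ∑ j, (Representation.trivial ℤ A ℤ).asModuleEquiv (x j) •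
        (Pi.single j 1 : Fin k → MonoidAlgebra ℤ C) := by
    rw [← Finset.univ_sum_single ((RingHom.RestrictedTarget.toTarget π).piConst k _)]
    refine Finset.sum_congr rfl fun j _ => ?_
    rw [← Pi.single_smul]
    congr 1
    change (single 1 _ : MonoidAlgebra ℤ C) = _
    rw [one_def, smul_single, smul_eq_mul, mul_one]
  rw [hx, map_sum]
  simp only [b, LinearMap.comp_apply, LinearMap.sum_apply, map_sum, LinearMap.smul_apply,
    map_zsmul]
  refine Finset.sum_congr rfl fun j _ => ?_
  exact mul_comm (_ : ℤ) _
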